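/- Let $\mathbb T=\{z\in\mathbb C:|z|=1\}$. A sequence $c=\{c_n\}_{n\ge 0}$ of positive real numbers belongs to the class $\mathcal X_-$ if $\lim_{n\to\infty} n(c_{n+1}-c_n)=+\infty$ and $\sum_{n=0}^\infty \frac{c_n}{n^2+1}<\infty$. For a bilateral sequence $a=\{a_n\}_{n\in\mathbb Z}$ of complex numbers and an integer $m\ge 0$ put $S^a_m(z)=\sum_{k=-m}^m a_kz^k$ for $z\in\mathbb T$. An interval in $\mathbb T$ is a closed connected subset of $\mathbb T$ of positive length. For an interval $J$ in $\mathbb T$, let $\mathcal R_a(J)$ be the set of all continuous functions $g:J\to\mathbb C$ for which there is a strictly increasing sequence $\{m_k\}_{k\ge 0}$ of positive integers such that $S^a_{m_k}(z)\to g(z)$ as $k\to\infty$ for every $z\in J$. Let $C_p(\mathbb T)$ be the space of continuous functions $\mathbb T\to\mathbb C$ with the topology of pointwise convergence. A bilateral series $\sum_{n=-\infty}^\infty x_n$ in a topological vector space $X$ is universal if for every $x\in X$ there is a strictly increasing sequence $\{n_k\}_{k\ge 0}$ of positive integers such that $\sum_{j=-n_k}^{n_k}x_j\to x$ as $k\to\infty$.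 **Theorem.** Let $\{a_n\}_{n\in\mathbb Z}$ be a bilateral sequence of complex numbers such that there exists $c\in\mathcal X_-$ with $|a_n|\le e^{c_{|n|}}$ for every $n\in\mathbb Z$. Then for every interval $J$ in $\mathbb T$, the set $\mathcal R_a(J)$ contains at most one element. In particular, the trigonometric series $\sum_{n=-\infty}^\infty a_nz^n$ is not universal in $C_p(\mathbb T)$. -/

import Mathlib

open Filter Topology MeasureTheory

/-- The class of sequences of positive reals `c₀, c₁, …` with `n (c_{n+1} - c_n) → +∞` and
`∑ c_n / (n² + 1) < ∞`. -/
structure ClassXMinus (c : ℕ → ℝ) : Prop where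
  pos : ∀ n, 0 < c n
  tendsto_diff : Tendsto (fun n : ℕ => (n : ℝ) * (c (n + 1) - c n)) atTop atTop
  summable : Summable (fun n : ℕ => c n / ((n : ℝ) ^ 2 + 1))

/-- The arc length of a subset of the unit circle: the Lebesgue measure of its preimage under
`t ↦ e^{it}` in the period `(-π, π]`. -/
noncomputable def circleLength (J : Set Circle) : ENNReal :=
  volume {t : ℝ | t ∈ Set.Ioc (-Real.pi) Real.pi ∧ Circle.exp t ∈ J}

/-- An interval in the circle: a closed connected subset of positive length. -/
structure IsCircleInterval (J : Set Circle) : Prop where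
  isClosed : IsClosed J
  isConnected : IsConnected J
  length_pos : 0 < circleLength J

/-- The symmetric partial sum `S^a_m(z) = ∑_{k=-m}^{m} a_k z^k`. -/
noncomputable def symPartialSum (a : ℤ → ℂ) (m : ℕ) (z : Circle) : ℂ :=
  ∑ k ∈ Finset.Icc (-(m : ℤ)) (m : ℤ), a k * (z : ℂ) ^ k

/-- The set `R_a(J)` of continuous functions on `J` that are pointwise limits on `J` of
`S^a_{m_k}` for some strictly increasing sequence `m_k` of positive integers. -/
def subseqLimits (a : ℤ → ℂ) (J : Set Circle) : Set C(J, ℂ) :=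
  {g | ∃ m : ℕ → ℕ, StrictMono m ∧ (∀ k, 0 < m k) ∧
    ∀ z : J, Tendsto (fun k => symPartialSum a (m k) (z : Circle)) atTop (𝓝 (g z))}

/-- The vector space `C(K)` of continuous complex-valued functions, to be endowed with the
topology of pointwise convergence. -/
def Cp (K : Type*) [TopologicalSpace K] : Type _ := C(K, ℂ)

noncomputable instance (K : Type*) [TopologicalSpace K] : AddCommGroup (Cp K) :=
  inferInstanceAs (AddCommGroup C(K, ℂ))

noncomputable instance (K : Type*) [TopologicalSpace K] : Module ℂ (Cp K) :=
  inferInstanceAs (Module ℂ C(K, ℂ))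

/-- The topology of pointwise convergence: the one induced by the product topology. -/
noncomputable instance (K : Type*) [TopologicalSpace K] : TopologicalSpace (Cp K) :=
  TopologicalSpace.induced (fun (f : C(K, ℂ)) (x : K) => f x) inferInstance

theorem Cp.isInducing (K : Type*) [TopologicalSpace K] :
    IsInducing (fun (f : Cp K) (x : K) => (show C(K, ℂ) from f) x) := ⟨rfl⟩

instance (K : Type*) [TopologicalSpace K] : IsTopologicalAddGroup (Cp K) :=
  (Cp.isInducing K).topologicalAddGroup
    ({ toFun := fun f x => (show C(K, ℂ) from f) x, map_zero' := rfl,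
       map_add' := fun _ _ => rfl } : Cp K →+ (K → ℂ))

instance (K : Type*) [TopologicalSpace K] : ContinuousSMul ℂ (Cp K) :=
  (Cp.isInducing K).continuousSMul continuous_id rfl

/-- A bilateral series `∑ x_n` is in a complex topological vector space is universal if every element of the space is the limit of
`∑_{j=-n_k}^{n_k} x_j` for some strictly increasing sequence `n_k` of positive integers. -/
def IsUniversalBilateralSeries {X : Type*} [AddCommGroup X] [Module ℂ X]
    [TopologicalSpace X] [IsTopologicalAddGroup X] [ContinuousSMul ℂ X] (x : ℤ → X) : Prop :=
  ∀ y : X, ∃ n : ℕ → ℕ, StrictMono n ∧ (∀ k, 0 < n k) ∧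
    Tendsto (fun k => ∑ j ∈ Finset.Icc (-(n k : ℤ)) (n k : ℤ), x j) atTop (𝓝 y)

/-- The monomial `z ↦ z^n` on the circle, as an element of `C_p(𝕋)`. -/
noncomputable def circleMonomial (n : ℤ) : Cp Circle :=
  (⟨fun z : Circle => ((z ^ n : Circle) : ℂ), Continuous.comp (g := ((↑) : Circle → ℂ)) (by fun_prop) (continuous_zpow n)⟩ : C(Circle, ℂ))

/-! The condition `∑ c_n / (n² + 1) < ∞` is a non-quasianalyticity condition: it yields probability
measures μ carried by `[0, ε]`, with ε arbitrarily small, whose Fourier coefficients are eventually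
at most `e^{-c_n} / n²` (`exists_measure_charFun_le`). Such a μ is the law of a sum of independent
uniform variables, that is, an infinite convolution of uniform laws.

Averaging `S^a_m(e^{i(x+s)})` in `s` against μ multiplies the coefficients by those of μ, and the
resulting series converges absolutely. Its sum does not depend on the subsequence of partial sums.
Where two subsequences are uniformly bounded, dominated convergence shows that the difference `G -
H` of their limits has zero mean against μ translated by `x`; letting ε shrink gives `G x = H x`
(`limits_eq_left_of_bounded`).

Pointwise convergence and Baire's theorem provide such bounds on some subinterval of every interval
(`exists_limits_eq`). So `G = H` on a dense set, and everywhere by continuity. -/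

/-! ### Laws of random series of uniform variables -/

/-- The uniform distribution on `[0, 1]`, as a measure on the line. -/
noncomputable def uniformUnit : Measure ℝ :=
  (volume : Measure unitInterval).map (fun x : unitInterval => (x : ℝ))

theorem norm_charFun_uniformUnit_le {t : ℝ} (ht : t ≠ 0) :
    ‖charFun uniformUnit t‖ ≤ 2 / |t| := by
  have hc : ((t : ℂ) * Complex.I) ≠ 0 := by simp [ht]
  have h : charFun uniformUnit t
      = (Complex.exp (t * Complex.I) - 1) / (t * Complex.I) := by
    rw [uniformUnit, unitInterval.measurePreserving_coe.map_eq, charFun_apply_real,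
      integral_Icc_eq_integral_Ioc, ← intervalIntegral.integral_of_le zero_le_one]
    have := integral_exp_mul_complex (a := 0) (b := 1) hc
    simp only [Complex.ofReal_one, mul_one, Complex.ofReal_zero, mul_zero, Complex.exp_zero]
      at this
    rw [← this]
    congr 1
    ext x
    ring_nf
  rw [h, norm_div, norm_mul, Complex.norm_I, mul_one, Complex.norm_real, Real.norm_eq_abs]
  gcongr
  calc _ ≤ ‖Complex.exp (t * Complex.I)‖ + ‖(1 : ℂ)‖ := norm_sub_le _ _
    _ = 2 := by rw [Complex.norm_exp_ofReal_mul_I, norm_one]; norm_num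

section RandomSeries

variable {ι : Type*} {δ : ι → ℝ}

/-- The random series `∑ δ_p U_p` with `U_p` independent and uniform on `[0, 1]`. -/
noncomputable def randomSeries (δ : ι → ℝ) (ω : ι → unitInterval) : ℝ := ∑' p, δ p * (ω p : ℝ)

theorem norm_mul_unitInterval_le (hδ : ∀ p, 0 ≤ δ p) (p : ι) (x : unitInterval) :
    ‖δ p * (x : ℝ)‖ ≤ δ p := by
  rw [Real.norm_eq_abs, abs_of_nonneg (mul_nonneg (hδ p) x.2.1)]
  exact mul_le_of_le_one_right (hδ p) x.2.2

theorem hasSum_randomSeries (hδ : ∀ p, 0 ≤ δ p) (hs : Summable δ) (ω : ι → unitInterval) :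
    HasSum (fun p => δ p * (ω p : ℝ)) (randomSeries δ ω) :=
  (Summable.of_norm_bounded hs fun p => norm_mul_unitInterval_le hδ p (ω p)).hasSum

theorem randomSeries_mem_Icc (hδ : ∀ p, 0 ≤ δ p) (hs : Summable δ) (ω : ι → unitInterval) :
    randomSeries δ ω ∈ Set.Icc 0 (∑' p, δ p) :=
  ⟨tsum_nonneg fun p => mul_nonneg (hδ p) (ω p).2.1,
    hasSum_le (fun p => (le_abs_self _).trans (norm_mul_unitInterval_le hδ p (ω p)))
      (hasSum_randomSeries hδ hs ω) hs.hasSum⟩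

theorem measurable_randomSeries [Countable ι] (hδ : ∀ p, 0 ≤ δ p) (hs : Summable δ) :
    Measurable (randomSeries δ) :=
  (continuous_tsum (f := fun p (ω : ι → unitInterval) => δ p * (ω p : ℝ)) (fun _ => by fun_prop) hs
    fun p ω => norm_mul_unitInterval_le hδ p (ω p)).measurable

theorem measurable_mul_coord (δ : ι → ℝ) (p : ι) :
    Measurable fun ω : ι → unitInterval => δ p * (ω p : ℝ) :=
  (measurable_subtype_coe.comp (measurable_pi_apply p)).const_mul _

theorem charFun_partialSum (δ : ι → ℝ) (s : Finset ι) (t : ℝ) :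
    ∫ ω, Complex.exp (t * (∑ p ∈ s, δ p * (ω p : ℝ) : ℝ) * Complex.I)
        ∂(Measure.infinitePi fun _ : ι => (volume : Measure unitInterval))
      = ∏ p ∈ s, charFun uniformUnit (δ p * t) := by
  set P := Measure.infinitePi fun _ : ι => (volume : Measure unitInterval)
  have hX : ProbabilityTheory.iIndepFun (fun p (ω : ι → unitInterval) => δ p * (ω p : ℝ)) P :=
    ProbabilityTheory.iIndepFun_infinitePi (X := fun p (x : unitInterval) => δ p * (x : ℝ))
      (fun _ => by fun_prop)
  have h := ProbabilityTheory.iIndepFun.charFun_map_fun_finsetSum_eq_prod (s := s)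
    (fun p _ => (measurable_mul_coord δ p).aemeasurable) (hX.restrict s)
  have h' := congrFun h t
  rw [charFun_apply_real, integral_map
    (Finset.measurable_fun_sum s fun p _ => measurable_mul_coord δ p).aemeasurable
    (by fun_prop)] at h'
  rw [h', Finset.prod_apply]
  refine Finset.prod_congr rfl fun p _ => ?_
  rw [← charFun_map_mul, uniformUnit, Measure.map_map (by fun_prop) (by fun_prop),
    ← Measure.infinitePi_map_eval (fun _ : ι => (volume : Measure unitInterval)) p,
    Measure.map_map (by fun_prop) (by fun_prop)]
  rfl

/-- The law of the random series `∑ δ_p U_p`. -/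
noncomputable def randomSeriesLaw (δ : ι → ℝ) : Measure ℝ :=
  (Measure.infinitePi fun _ : ι => (volume : Measure unitInterval)).map (randomSeries δ)

variable [Countable ι]

theorem isProbabilityMeasure_randomSeriesLaw (hδ : ∀ p, 0 ≤ δ p) (hs : Summable δ) :
    IsProbabilityMeasure (randomSeriesLaw δ) :=
  Measure.isProbabilityMeasure_map (measurable_randomSeries hδ hs).aemeasurable

theorem randomSeriesLaw_ae_mem_Icc (hδ : ∀ p, 0 ≤ δ p) (hs : Summable δ) :
    ∀ᵐ x ∂(randomSeriesLaw δ), x ∈ Set.Icc 0 (∑' p, δ p) := by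
  exact (ae_map_iff (measurable_randomSeries hδ hs).aemeasurable measurableSet_Icc).2
    (ae_of_all _ (randomSeries_mem_Icc hδ hs))

theorem tendsto_prod_charFun_randomSeriesLaw (hδ : ∀ p, 0 ≤ δ p) (hs : Summable δ) (t : ℝ) :
    Tendsto (fun s : Finset ι => ∏ p ∈ s, charFun uniformUnit (δ p * t)) atTop
      (𝓝 (charFun (randomSeriesLaw δ) t)) := by
  rw [charFun_apply_real, randomSeriesLaw,
    integral_map (measurable_randomSeries hδ hs).aemeasurable (by fun_prop)]
  simp_rw [← charFun_partialSum]
  refine tendsto_integral_filter_of_dominated_convergence (fun _ => 1)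
    (Eventually.of_forall fun s => ?_) (Eventually.of_forall fun s => ae_of_all _ fun ω => ?_)
    (integrable_const _) (ae_of_all _ fun ω => ?_)
  · exact Measurable.aestronglyMeasurable (by fun_prop)
  · rw [← Complex.ofReal_mul, Complex.norm_exp_ofReal_mul_I]
  · have hcont : Continuous fun x : ℝ => Complex.exp (t * x * Complex.I) := by fun_prop
    exact (hcont.tendsto _).comp (hasSum_randomSeries hδ hs ω)

instance : IsProbabilityMeasure uniformUnit :=
  Measure.isProbabilityMeasure_map (by fun_prop)

/-- Each factor of the infinite product has modulus at most 1, so the factors outside `s` can be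
dropped; on `s` the bound `2 / |δ p * t|` is at most `e⁻¹`. -/
theorem norm_charFun_randomSeriesLaw_le (hδ : ∀ p, 0 ≤ δ p) (hs : Summable δ) {t : ℝ}
    (s : Finset ι) (h : ∀ p ∈ s, 2 * Real.exp 1 ≤ |δ p * t|) :
    ‖charFun (randomSeriesLaw δ) t‖ ≤ Real.exp (-(s.card : ℝ)) := by
  classical
  refine le_of_tendsto (tendsto_prod_charFun_randomSeriesLaw hδ hs t).norm ?_
  filter_upwards [eventually_ge_atTop s] with u hu
  rw [norm_prod]
  calc ∏ p ∈ u, ‖charFun uniformUnit (δ p * t)‖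
      ≤ ∏ p ∈ s, ‖charFun uniformUnit (δ p * t)‖ :=
        Finset.prod_le_prod_of_subset_of_le_one hu (fun _ _ => norm_nonneg _)
          fun _ _ _ => norm_charFun_le_one _
    _ ≤ ∏ p ∈ s, Real.exp (-1) := by
        refine Finset.prod_le_prod (fun _ _ => norm_nonneg _) fun p hp => ?_
        have hp' := h p hp
        have hpos : 0 < |δ p * t| := lt_of_lt_of_le (by positivity) hp'
        refine (norm_charFun_uniformUnit_le (abs_pos.1 hpos)).trans ?_
        rw [div_le_iff₀ hpos, Real.exp_neg]
        rw [inv_mul_eq_div, le_div_iff₀ (Real.exp_pos _)]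
        exact hp'
    _ = Real.exp (-(s.card : ℝ)) := by
        rw [Finset.prod_const, ← Real.exp_nat_mul]; ring_nf

end RandomSeries

/-! ### Measures of short support with prescribed Fourier decay -/

/-- Cauchy condensation: the block `[2^j, 2^(j+1))` has `2^j` terms, each at least `c (2^j) / (4 *
4^j)`, because `n² + 1 ≤ (n + 1)² ≤ 4 * 4^j`. -/
theorem summable_dyadic {c : ℕ → ℝ} (hmono : Monotone c) (hc : ∀ n, 0 ≤ c n)
    (hs : Summable fun n : ℕ => c n / ((n : ℝ) ^ 2 + 1)) :
    Summable fun j : ℕ => c (2 ^ j) / 2 ^ j := by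
  have hpos : ∀ n : ℕ, 0 ≤ c n / ((n : ℝ) ^ 2 + 1) := fun n => div_nonneg (hc n) (by positivity)
  have hblock : ∀ j : ℕ, c (2 ^ j) / 2 ^ j
      ≤ 4 * ∑ n ∈ Finset.Ico (2 ^ j) (2 ^ (j + 1)), c n / ((n : ℝ) ^ 2 + 1) := by
    intro j
    have : ∑ n ∈ Finset.Ico (2 ^ j) (2 ^ (j + 1)), c (2 ^ j) / (4 * ((2 : ℝ) ^ j) ^ 2)
        ≤ ∑ n ∈ Finset.Ico (2 ^ j) (2 ^ (j + 1)), c n / ((n : ℝ) ^ 2 + 1) := by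
      refine Finset.sum_le_sum fun n hn => ?_
      rw [Finset.mem_Ico] at hn
      have h1 : (n : ℝ) + 1 ≤ 2 * 2 ^ j := by
        have : n + 1 ≤ 2 * 2 ^ j := by rw [pow_succ] at hn; omega
        exact_mod_cast this
      have h0 : (0 : ℝ) ≤ n := n.cast_nonneg
      refine div_le_div₀ (hc n) (hmono hn.1) (by positivity) ?_
      nlinarith
    rw [Finset.sum_const, Nat.card_Ico, pow_succ, show 2 ^ j * 2 - 2 ^ j = 2 ^ j by omega,
      nsmul_eq_mul] at this
    push_cast at this
    rw [pow_succ]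
    refine le_trans (le_of_eq ?_) (mul_le_mul_of_nonneg_left this (by norm_num))
    field_simp
  refine summable_of_sum_range_le (c := 4 * ∑' n : ℕ, c n / ((n : ℝ) ^ 2 + 1))
    (fun j => div_nonneg (hc _) (by positivity)) fun K => ?_
  refine (Finset.sum_le_sum fun j _ => hblock j).trans ?_
  rw [← Finset.mul_sum]
  refine mul_le_mul_of_nonneg_left ?_ (by norm_num)
  have : ∀ K : ℕ, ∑ j ∈ Finset.range K, ∑ n ∈ Finset.Ico (2 ^ j) (2 ^ (j + 1)),
      c n / ((n : ℝ) ^ 2 + 1) = ∑ n ∈ Finset.Ico 1 (2 ^ K), c n / ((n : ℝ) ^ 2 + 1) := by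
    intro K
    induction K with
    | zero => simp
    | succ K ih =>
      rw [Finset.sum_range_succ, ih, Finset.sum_Ico_consecutive _ Nat.one_le_two_pow
        (Nat.pow_le_pow_right (by norm_num) (by omega))]
  rw [this]
  exact hs.sum_le_tsum _ fun n _ => hpos n

/-- Short-range probability measures whose Fourier coefficients decay like any non-quasianalytic
weight. -/
theorem exists_measure_charFun_le {c : ℕ → ℝ} (hmono : Monotone c) (hc : ∀ n, 0 ≤ c n)
    (hs : Summable fun n : ℕ => c n / ((n : ℝ) ^ 2 + 1)) {ε : ℝ} (hε : 0 < ε) :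
    ∃ μ : Measure ℝ, IsProbabilityMeasure μ ∧ (∀ᵐ x ∂μ, x ∈ Set.Icc 0 ε) ∧
      ∃ N : ℕ, ∀ n : ℕ, N ≤ n → ‖charFun μ n‖ ≤ Real.exp (-c n) / (n : ℝ) ^ 2 := by
  -- For `2^j ≤ n < 2^(j+1)`, the `ν j` uniform variables of scale `ρ j` each contribute a factor at
  -- most `e⁻¹`, since `ρ j * n ≥ 2e`. The ceiling pays for `e^{-c n}`, and `2 * (j + 1)` for `1 /
  -- n²`, since `n ≤ e^(j+1)`.
  set ν : ℕ → ℕ := fun j => ⌈c (2 ^ (j + 1))⌉₊ + 2 * (j + 1) with hν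
  set ρ : ℕ → ℝ := fun j => 2 * Real.exp 1 / 2 ^ j with hρ
  have hρpos : ∀ j, 0 < ρ j := fun j => by positivity
  have hsum : Summable fun j => (ν j : ℝ) * ρ j := by
    have h1 : Summable fun j : ℕ => c (2 ^ (j + 1)) / 2 ^ (j + 1) :=
      (summable_nat_add_iff 1).2 (summable_dyadic hmono hc hs)
    have h2 : Summable fun j : ℕ => (j : ℝ) * (1 / 2) ^ j := by
      simpa using summable_pow_mul_geometric_of_norm_lt_one 1
        (r := (1 / 2 : ℝ)) (by norm_num)
    have h3 : Summable fun j : ℕ => ((1 : ℝ) / 2) ^ j := summable_geometric_two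
    refine Summable.of_nonneg_of_le (fun j => by positivity) (fun j => ?_)
      (((h1.mul_left 2).add ((h2.mul_left 2).add (h3.mul_left 3))).mul_left (2 * Real.exp 1))
    have hceil := (Nat.ceil_lt_add_one (hc (2 ^ (j + 1)))).le
    have hν' : (ν j : ℝ) ≤ c (2 ^ (j + 1)) + 2 * j + 3 := by
      simp only [hν]; push_cast; linarith
    calc (ν j : ℝ) * ρ j ≤ (c (2 ^ (j + 1)) + 2 * j + 3) * ρ j :=
          mul_le_mul_of_nonneg_right hν' (hρpos j).le
      _ = _ := by
          simp only [hρ, one_div, inv_pow, pow_succ]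
          field_simp
          ring
  -- Discarding the scales below `J` shortens the support to `ε`; the decay then holds only from `2
  -- ^ J` on.
  obtain ⟨J, hJ⟩ : ∃ J : ℕ, ∑' j, ((ν (j + J) : ℝ) * ρ (j + J)) ≤ ε :=
    (((tendsto_sum_nat_add fun j => (ν j : ℝ) * ρ j).eventually_lt_const hε).exists).imp
      fun _ h => h.le
  let δ : (Σ j : ℕ, Fin (ν (j + J))) → ℝ := fun p => ρ (p.1 + J)
  have hδ : ∀ p, 0 ≤ δ p := fun p => (hρpos _).le
  have hsumJ : Summable fun j => (ν (j + J) : ℝ) * ρ (j + J) :=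
    (summable_nat_add_iff (f := fun j => (ν j : ℝ) * ρ j) J).2 hsum
  have hδs : Summable δ :=
    (summable_sigma_of_nonneg hδ).2 ⟨fun j => Summable.of_finite, by simpa [δ] using hsumJ⟩
  have htsum : ∑' p, δ p ≤ ε := by
    rw [hδs.tsum_sigma]
    simpa [δ] using hJ
  refine ⟨randomSeriesLaw δ, isProbabilityMeasure_randomSeriesLaw hδ hδs,
    (randomSeriesLaw_ae_mem_Icc hδ hδs).mono fun x hx => ⟨hx.1, hx.2.trans htsum⟩, 2 ^ J,
    fun n hn => ?_⟩
  have hn0 : n ≠ 0 := by have := Nat.one_le_two_pow (n := J); omega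
  obtain ⟨j, hj⟩ : ∃ j, Nat.log 2 n = j + J :=
    ⟨Nat.log 2 n - J, by have := Nat.le_log_of_pow_le (by norm_num) hn; omega⟩
  have hle : 2 ^ (j + J) ≤ n := hj ▸ Nat.pow_log_le_self 2 hn0
  have hlt : n < 2 ^ (j + J + 1) := hj ▸ Nat.lt_pow_succ_log_self (by norm_num) n
  have hb := norm_charFun_randomSeriesLaw_le hδ hδs (t := n)
    (Finset.univ.map (Function.Embedding.sigmaMk (β := fun j => Fin (ν (j + J))) j)) (by
      intro p hp
      obtain ⟨i, -, rfl⟩ := Finset.mem_map.1 hp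
      have h1 : ((2 : ℝ) ^ (j + J)) ≤ n := by exact_mod_cast hle
      refine le_trans ?_ (le_abs_self _)
      change 2 * Real.exp 1 ≤ 2 * Real.exp 1 / 2 ^ (j + J) * n
      rw [div_mul_eq_mul_div, le_div_iff₀ (by positivity)]
      gcongr)
  refine hb.trans ?_
  rw [Finset.card_map, Finset.card_univ, Fintype.card_fin, le_div_iff₀ (by positivity)]
  have hn1 : (n : ℝ) ≤ Real.exp (j + J + 1 : ℕ) := by
    have h2 : (n : ℝ) ≤ 2 ^ (j + J + 1) := by exact_mod_cast hlt.le
    refine h2.trans ?_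
    rw [← Real.exp_one_pow]
    exact pow_le_pow_left₀ (by norm_num) (by have := Real.add_one_le_exp 1; linarith) _
  calc Real.exp (-(ν (j + J) : ℝ)) * (n : ℝ) ^ 2
      ≤ Real.exp (-(ν (j + J) : ℝ)) * Real.exp (j + J + 1 : ℕ) ^ 2 := by gcongr
    _ = Real.exp (-(⌈c (2 ^ (j + J + 1))⌉₊ : ℝ)) := by
        rw [← Real.exp_nat_mul, ← Real.exp_add]
        simp only [hν]; push_cast; ring_nf
    _ ≤ Real.exp (-c n) := by
        refine Real.exp_le_exp.2 (neg_le_neg ((hmono hlt.le).trans (Nat.le_ceil _)))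

/-- The differences of `c` are eventually nonnegative, so freezing `c` before that threshold makes
it monotone and changes finitely many terms. -/
theorem ClassXMinus.exists_monotone {c : ℕ → ℝ} (h : ClassXMinus c) :
    ∃ d : ℕ → ℝ, Monotone d ∧ (∀ n, 0 ≤ d n) ∧
      (Summable fun n : ℕ => d n / ((n : ℝ) ^ 2 + 1)) ∧ ∃ N, ∀ n, N ≤ n → d n = c n := by
  obtain ⟨N, hN⟩ := eventually_atTop.1 (h.tendsto_diff.eventually_ge_atTop 0)
  have hstep : ∀ n, max N 1 ≤ n → c n ≤ c (n + 1) := by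
    intro n hn
    have h1 := hN n (le_of_max_le_left hn)
    have h2 : (0 : ℝ) < n := by exact_mod_cast le_of_max_le_right hn
    exact sub_nonneg.1 (nonneg_of_mul_nonneg_right h1 h2)
  refine ⟨fun n => c (max n (max N 1)), monotone_nat_of_le_succ fun n => ?_,
    fun n => (h.pos _).le, ?_, max N 1, fun n hn => congrArg c (max_eq_left hn)⟩
  · rcases le_or_gt (max N 1) n with hn | hn
    · rw [max_eq_left hn, max_eq_left (hn.trans n.le_succ)]
      exact hstep n hn
    · exact (congrArg c ((max_eq_right hn.le).trans (max_eq_right hn).symm)).le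
  · refine (summable_nat_add_iff (max N 1)).1 ?_
    refine ((summable_nat_add_iff (max N 1)).2 h.summable).congr fun n => ?_
    beta_reduce
    rw [max_eq_left (Nat.le_add_left (max N 1) n)]

/-! ### Averaged partial sums and coincidence of limits -/

theorem summable_mul_charFun {a : ℤ → ℂ} {c : ℕ → ℝ} {N₀ N : ℕ}
    (ha : ∀ n : ℤ, N₀ ≤ n.natAbs → ‖a n‖ ≤ Real.exp (c n.natAbs)) {μ : Measure ℝ}
    (hμ : ∀ n : ℕ, N ≤ n → ‖charFun μ n‖ ≤ Real.exp (-c n) / (n : ℝ) ^ 2) (x : ℝ) :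
    Summable fun n : ℤ => a n * Complex.exp (n * x * Complex.I) * charFun μ n := by
  have hs : Summable fun n : ℤ => 1 / ((n : ℝ)) ^ 2 :=
    Real.summable_one_div_int_pow.2 one_lt_two
  refine Summable.of_norm_bounded_eventually hs ?_
  have hfin : {n : ℤ | n.natAbs < max N₀ N}.Finite := by
    refine (Set.finite_Icc (-(max N₀ N : ℤ)) (max N₀ N : ℤ)).subset fun n hn => ?_
    simp only [Set.mem_ofPred_eq] at hn
    rw [Set.mem_Icc]
    omega
  refine hfin.subset fun n hn => ?_
  simp only [Set.mem_compl_iff, Set.mem_ofPred_eq] at hn ⊢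
  by_contra! hge
  refine hn ?_
  have h1 := ha n (le_of_max_le_left hge)
  have h2 : ‖charFun μ (n : ℝ)‖ ≤ Real.exp (-c n.natAbs) / (n : ℝ) ^ 2 := by
    have h3 := hμ n.natAbs (le_of_max_le_right hge)
    have h4 : ((n.natAbs : ℕ) : ℝ) = |(n : ℝ)| := by rw [Nat.cast_natAbs, Int.cast_abs]
    rw [h4, sq_abs] at h3
    -- Negative frequencies reduce to positive ones by conjugate symmetry of the characteristic
    -- function.
    rcases abs_choice (n : ℝ) with h5 | h5 <;> rw [h5] at h3
    · exact h3
    · rwa [charFun_neg, RCLike.norm_conj] at h3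
  rw [norm_mul, norm_mul, ← Complex.ofReal_intCast, ← Complex.ofReal_mul,
    Complex.norm_exp_ofReal_mul_I, mul_one]
  calc ‖a n‖ * ‖charFun μ (n : ℝ)‖
      ≤ Real.exp (c n.natAbs) * (Real.exp (-c n.natAbs) / (n : ℝ) ^ 2) := by gcongr
    _ = 1 / (n : ℝ) ^ 2 := by
        rw [← mul_div_assoc, ← Real.exp_add, add_neg_cancel, Real.exp_zero]

theorem symPartialSum_exp (a : ℤ → ℂ) (m : ℕ) (x : ℝ) :
    symPartialSum a m (Circle.exp x)
      = ∑ k ∈ Finset.Icc (-(m : ℤ)) (m : ℤ), a k * Complex.exp (k * x * Complex.I) := by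
  refine Finset.sum_congr rfl fun k _ => ?_
  rw [Circle.coe_exp, ← Complex.exp_int_mul, mul_assoc]

theorem continuous_symPartialSum_exp (a : ℤ → ℂ) (m : ℕ) :
    Continuous fun x : ℝ => symPartialSum a m (Circle.exp x) := by
  simp_rw [symPartialSum_exp]
  fun_prop

theorem integral_symPartialSum (a : ℤ → ℂ) (m : ℕ) (x : ℝ) (μ : Measure ℝ)
    [IsProbabilityMeasure μ] :
    ∫ s, symPartialSum a m (Circle.exp (x + s)) ∂μ
      = ∑ k ∈ Finset.Icc (-(m : ℤ)) (m : ℤ),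
        a k * Complex.exp (k * x * Complex.I) * charFun μ k := by
  simp_rw [symPartialSum_exp]
  have hint : ∀ k : ℤ, Integrable (fun s : ℝ => Complex.exp ((k : ℝ) * s * Complex.I)) μ :=
    fun k => Integrable.of_bound (by fun_prop) 1 (ae_of_all _ fun s => by
      rw [← Complex.ofReal_mul, Complex.norm_exp_ofReal_mul_I])
  have hexp : ∀ (k : ℤ) (s : ℝ), a k * Complex.exp (k * ((x + s : ℝ) : ℂ) * Complex.I)
      = a k * Complex.exp (k * x * Complex.I) * Complex.exp ((k : ℝ) * s * Complex.I) := by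
    intro k s
    rw [mul_assoc (a k), ← Complex.exp_add]
    push_cast
    ring_nf
  simp_rw [hexp]
  rw [integral_finsetSum _ fun k _ => (hint k).const_mul _]
  refine Finset.sum_congr rfl fun k _ => ?_
  rw [integral_const_mul, charFun_apply_real]

theorem tendsto_Icc_neg_atTop {m : ℕ → ℕ} (hm : StrictMono m) :
    Tendsto (fun k => Finset.Icc (-(m k : ℤ)) (m k : ℤ)) atTop atTop := by
  refine tendsto_atTop_finset_of_monotone (fun i j hij => ?_) fun n => ⟨n.natAbs, ?_⟩
  · have := hm.monotone hij
    exact Finset.Icc_subset_Icc (by omega) (by omega)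
  · have := hm.le_apply (x := n.natAbs)
    rw [Finset.mem_Icc]
    omega

/-- Uniformly bounded subsequences of partial sums have the same limit at the left endpoint. -/
theorem limits_eq_left_of_bounded {a : ℤ → ℂ} {c : ℕ → ℝ} {N₀ : ℕ} (hmono : Monotone c)
    (hc : ∀ n, 0 ≤ c n) (hs : Summable fun n : ℕ => c n / ((n : ℝ) ^ 2 + 1))
    (ha : ∀ n : ℤ, N₀ ≤ n.natAbs → ‖a n‖ ≤ Real.exp (c n.natAbs))
    {m m' : ℕ → ℕ} (hm : StrictMono m) (hm' : StrictMono m') {x y M : ℝ} (hxy : x < y)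
    {G H : ℝ → ℂ} (hG : ContinuousOn G (Set.Icc x y)) (hH : ContinuousOn H (Set.Icc x y))
    (hGlim : ∀ t ∈ Set.Icc x y,
      Tendsto (fun k => symPartialSum a (m k) (Circle.exp t)) atTop (𝓝 (G t)))
    (hHlim : ∀ t ∈ Set.Icc x y,
      Tendsto (fun k => symPartialSum a (m' k) (Circle.exp t)) atTop (𝓝 (H t)))
    (hGM : ∀ t ∈ Set.Icc x y, ∀ k, ‖symPartialSum a (m k) (Circle.exp t)‖ ≤ M)
    (hHM : ∀ t ∈ Set.Icc x y, ∀ k, ‖symPartialSum a (m' k) (Circle.exp t)‖ ≤ M) :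
    G x = H x := by
  set D : ℝ → ℂ := fun t => G t - H t with hD
  suffices ∀ η > 0, ‖D x‖ ≤ η by
    exact sub_eq_zero.1 (norm_le_zero_iff.1 (le_of_forall_pos_le_add fun η hη => by
      simpa using this η hη))
  intro η hη
  have hDc : ContinuousWithinAt D (Set.Icc x y) x :=
    (hG.sub hH) x (Set.left_mem_Icc.2 hxy.le)
  obtain ⟨r, hr, hrD⟩ := Metric.continuousWithinAt_iff.1 hDc η hη
  obtain ⟨μ, hμ, hsupp, N, hN⟩ :=
    exists_measure_charFun_le hmono hc hs (ε := min (r / 2) (y - x))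
      (lt_min (half_pos hr) (sub_pos.2 hxy))
  have hsupp' : ∀ᵐ s ∂μ, x + s ∈ Set.Icc x y ∧ ‖D (x + s) - D x‖ ≤ η := by
    filter_upwards [hsupp] with s hs
    have h1 := hs.2.trans (min_le_left _ _)
    have h2 := hs.2.trans (min_le_right _ _)
    have hmem : x + s ∈ Set.Icc x y := ⟨by linarith [hs.1], by linarith⟩
    refine ⟨hmem, ?_⟩
    rw [← dist_eq_norm]
    refine (hrD hmem ?_).le
    rw [Real.dist_eq, add_sub_cancel_left, abs_of_nonneg hs.1]
    linarith
  set F : ℕ → ℝ → ℂ := fun k s => symPartialSum a (m k) (Circle.exp (x + s))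
    - symPartialSum a (m' k) (Circle.exp (x + s)) with hF
  have hcont : ∀ n : ℕ, Continuous fun s : ℝ => symPartialSum a n (Circle.exp (x + s)) :=
    fun n => (continuous_symPartialSum_exp a n).comp (by fun_prop)
  have hi : ∀ k, Integrable (fun s => symPartialSum a (m k) (Circle.exp (x + s))) μ := fun k =>
    Integrable.of_bound (hcont _).aestronglyMeasurable M
      (hsupp'.mono fun s hs => hGM _ hs.1 k)
  have hi' : ∀ k, Integrable (fun s => symPartialSum a (m' k) (Circle.exp (x + s))) μ := fun k =>
    Integrable.of_bound (hcont _).aestronglyMeasurable M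
      (hsupp'.mono fun s hs => hHM _ hs.1 k)
  have hsum := (summable_mul_charFun ha hN x).hasSum
  -- Both averages converge to the same absolutely convergent sum, so their difference tends to 0
  -- and only the constant `-D x` survives.
  have hF0 : Tendsto (fun k => ∫ s, (F k s - D x) ∂μ) atTop (𝓝 (-D x)) := by
    have h1 := (hsum.comp (tendsto_Icc_neg_atTop hm)).sub
      (hsum.comp (tendsto_Icc_neg_atTop hm'))
    have h2 := h1.sub_const (D x)
    rw [sub_self, zero_sub] at h2
    refine h2.congr fun k => ?_
    have hFk : ∫ s, F k s ∂μ = _ := integral_sub (hi k) (hi' k)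
    rw [integral_sub (f := F k) ((hi k).sub (hi' k)) (integrable_const _), hFk,
      integral_symPartialSum, integral_symPartialSum, integral_const]
    simp
  have hF1 : Tendsto (fun k => ∫ s, (F k s - D x) ∂μ) atTop (𝓝 (∫ s, (D (x + s) - D x) ∂μ)) := by
    refine tendsto_integral_of_dominated_convergence (fun _ => M + M + ‖D x‖)
      (fun k => (((hi k).sub (hi' k)).sub (integrable_const _)).aestronglyMeasurable)
      (integrable_const _) (fun k => hsupp'.mono fun s hs => ?_) (hsupp'.mono fun s hs => ?_)
    · exact (norm_sub_le _ _).trans (add_le_add_left ((norm_sub_le _ _).trans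
        (add_le_add (hGM _ hs.1 k) (hHM _ hs.1 k))) _)
    · exact ((hGlim _ hs.1).sub (hHlim _ hs.1)).sub_const _
  have heq := tendsto_nhds_unique hF0 hF1
  rw [← norm_neg, heq]
  refine (norm_integral_le_of_norm_le_const (hsupp'.mono fun s hs => hs.2)).trans ?_
  simp

/-- Two subsequential limits of the partial sums agree somewhere on each nontrivial interval. -/
theorem exists_limits_eq {a : ℤ → ℂ} {c : ℕ → ℝ} {N₀ : ℕ} (hmono : Monotone c)
    (hc : ∀ n, 0 ≤ c n) (hs : Summable fun n : ℕ => c n / ((n : ℝ) ^ 2 + 1))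
    (ha : ∀ n : ℤ, N₀ ≤ n.natAbs → ‖a n‖ ≤ Real.exp (c n.natAbs))
    {m m' : ℕ → ℕ} (hm : StrictMono m) (hm' : StrictMono m') {x y : ℝ} (hxy : x < y)
    {G H : ℝ → ℂ} (hG : ContinuousOn G (Set.Icc x y)) (hH : ContinuousOn H (Set.Icc x y))
    (hGlim : ∀ t ∈ Set.Icc x y,
      Tendsto (fun k => symPartialSum a (m k) (Circle.exp t)) atTop (𝓝 (G t)))
    (hHlim : ∀ t ∈ Set.Icc x y,
      Tendsto (fun k => symPartialSum a (m' k) (Circle.exp t)) atTop (𝓝 (H t))) :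
    ∃ t ∈ Set.Icc x y, G t = H t := by
  set B : ℕ → Set ℝ := fun M => {t | ∀ k, ‖symPartialSum a (m k) (Circle.exp t)‖ ≤ M} ∩
    {t | ∀ k, ‖symPartialSum a (m' k) (Circle.exp t)‖ ≤ M} with hB
  have hclosed : ∀ (l : ℕ → ℕ) (M : ℕ),
      IsClosed {t : ℝ | ∀ k, ‖symPartialSum a (l k) (Circle.exp t)‖ ≤ M} := fun l M => by
    simp only [Set.ofPred_forall]
    exact isClosed_iInter fun k =>
      isClosed_le (continuous_symPartialSum_exp a (l k)).norm continuous_const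
  -- Adjoining the closed complement of `Ioo x y` makes the sets cover the whole line; inside `Ioo x
  -- y` it adds nothing.
  have hdense := dense_iUnion_interior_of_closed
    (f := fun M => B M ∪ (Set.Ioo x y)ᶜ)
    (fun M => ((hclosed m M).inter (hclosed m' M)).union isOpen_Ioo.isClosed_compl) (by
      refine Set.eq_univ_of_forall fun t => Set.mem_iUnion.2 ?_
      by_cases ht : t ∈ Set.Ioo x y
      · obtain ⟨M₁, h₁⟩ := (hGlim t (Set.Ioo_subset_Icc_self ht)).norm.bddAbove_range
        obtain ⟨M₂, h₂⟩ := (hHlim t (Set.Ioo_subset_Icc_self ht)).norm.bddAbove_range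
        obtain ⟨M, hM⟩ := exists_nat_ge (max M₁ M₂)
        exact ⟨M, Or.inl ⟨
          fun k => (h₁ ⟨k, rfl⟩).trans ((le_max_left _ _).trans hM),
          fun k => (h₂ ⟨k, rfl⟩).trans ((le_max_right _ _).trans hM)⟩⟩
      · exact ⟨0, Or.inr ht⟩)
  obtain ⟨t, htxy, ht⟩ := hdense.inter_open_nonempty _ isOpen_Ioo (Set.nonempty_Ioo.2 hxy)
  obtain ⟨M, htM⟩ := Set.mem_iUnion.1 ht
  have hnhds : interior (B M ∪ (Set.Ioo x y)ᶜ) ∩ Set.Ioo x y ∈ 𝓝[≥] t :=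
    mem_nhdsWithin_of_mem_nhds ((isOpen_interior.inter isOpen_Ioo).mem_nhds ⟨htM, htxy⟩)
  obtain ⟨u, hu, hsub⟩ := mem_nhdsGE_iff_exists_Icc_subset.1 hnhds
  have hIcc : Set.Icc t u ⊆ Set.Icc x y := fun s hs => Set.Ioo_subset_Icc_self (hsub hs).2
  have hBM : ∀ s ∈ Set.Icc t u, s ∈ B M := fun s hs =>
    (interior_subset (hsub hs).1).resolve_right fun h => h (hsub hs).2
  exact ⟨t, Set.Ioo_subset_Icc_self htxy,
    limits_eq_left_of_bounded hmono hc hs ha hm hm' hu (hG.mono hIcc) (hH.mono hIcc)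
      (fun s hs => hGlim s (hIcc hs)) (fun s hs => hHlim s (hIcc hs))
      (fun s hs => (hBM s hs).1) (fun s hs => (hBM s hs).2)⟩

/-! ### Arcs of the circle and passage to the real line -/

theorem IsCircleInterval.nontrivial {J : Set Circle} (hJ : IsCircleInterval J) :
    J.Nontrivial := by
  by_contra h
  rw [Set.not_nontrivial_iff] at h
  refine hJ.length_pos.ne' (Set.Subsingleton.measure_zero (fun s hs t ht => ?_) _)
  exact Circle.exp_injOn_Ioc (by linarith) hs.1 ht.1 (h hs.2 ht.2)

/-- Every point of a nontrivial connected set of the circle is an endpoint of an arc in it. -/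
theorem exists_arc_subset {J : Set Circle} (hJ : IsPreconnected J) (hnt : J.Nontrivial)
    {z : Circle} (hz : z ∈ J) :
    ∃ x y : ℝ, x < y ∧ (∀ t ∈ Set.Icc x y, Circle.exp t ∈ J) ∧
      (Circle.exp x = z ∨ Circle.exp y = z) := by
  by_cases huniv : J = Set.univ
  · exact ⟨Complex.arg z, Complex.arg z + 1, by linarith, by simp [huniv],
      Or.inl (Circle.exp_arg z)⟩
  obtain ⟨w, hw⟩ := (Set.ne_univ_iff_exists_notMem J).1 huniv
  -- The branch of the argument cut at the missing point `w`: it takes the value `π` only at `u =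
  -- w`, so it is continuous on `J`.
  set f : Circle → ℝ := fun u => Complex.arg (-(u / w : Circle) : ℂ) with hf
  have hexp : ∀ u, Circle.exp (f u + (Real.pi + Complex.arg w)) = u := by
    intro u
    apply Circle.ext
    rw [← add_assoc, Circle.exp_add, Circle.exp_add, Circle.exp_arg, Circle.coe_mul,
      Circle.coe_mul]
    have h1 : ((Circle.exp (f u) : Circle) : ℂ) = -(u / w : Circle) := by
      have h := Complex.norm_mul_exp_arg_mul_I (-(u / w : Circle) : ℂ)
      rwa [norm_neg, Circle.norm_coe, Complex.ofReal_one, one_mul, ← Circle.coe_exp] at h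
    rw [h1, Circle.coe_exp, Complex.exp_pi_mul_I, Circle.coe_div]
    have hw0 : (w : ℂ) ≠ 0 := Circle.coe_ne_zero w
    field_simp
  have hcont : ContinuousOn f J := by
    intro u hu
    refine ((Complex.continuousAt_arg ?_).comp (f := fun u : Circle => (-(u / w : Circle) : ℂ))
      (by fun_prop)).continuousWithinAt
    rw [Complex.mem_slitPlane_iff_arg]
    refine ⟨fun hpi => hw ?_, neg_ne_zero.2 (Circle.coe_ne_zero _)⟩
    have := hexp u
    rw [show f u = Real.pi from hpi, show Real.pi + (Real.pi + Complex.arg w)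
      = Complex.arg w + 2 * Real.pi by ring, Circle.exp_add_two_pi, Circle.exp_arg] at this
    rwa [this]
  have hord : (f '' J).OrdConnected := (hJ.image f hcont).ordConnected
  have hmem : ∀ u ∈ J, ∀ v ∈ J, ∀ t ∈ Set.Icc (f u + (Real.pi + Complex.arg w))
      (f v + (Real.pi + Complex.arg w)), Circle.exp t ∈ J := by
    intro u hu v hv t ht
    obtain ⟨q, hq, hqt⟩ := hord.out (Set.mem_image_of_mem f hu) (Set.mem_image_of_mem f hv)
      (show t - (Real.pi + Complex.arg w) ∈ _ from ⟨by linarith [ht.1], by linarith [ht.2]⟩)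
    rw [← sub_add_cancel t (Real.pi + Complex.arg w), ← hqt, hexp]
    exact hq
  obtain ⟨v, hv, hvz⟩ := hnt.exists_ne z
  have hne : f v ≠ f z := fun h => hvz (by rw [← hexp v, h, hexp])
  rcases hne.lt_or_gt with h | h
  · exact ⟨_, _, by linarith, hmem v hv z hz, Or.inr (hexp z)⟩
  · exact ⟨_, _, by linarith, hmem z hz v hv, Or.inl (hexp z)⟩

/-- If the values differed at an endpoint, they would differ on a one-sided neighbourhood of it,
which contains no coincidence point. -/
theorem eq_endpoints_of_forall_exists_eq {G H : ℝ → ℂ} {x y : ℝ} (hxy : x < y)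
    (hG : ContinuousOn G (Set.Icc x y)) (hH : ContinuousOn H (Set.Icc x y))
    (h : ∀ u v, x ≤ u → u < v → v ≤ y → ∃ t ∈ Set.Icc u v, G t = H t) :
    G x = H x ∧ G y = H y := by
  constructor <;> by_contra hne
  · have hev := ((hG x (Set.left_mem_Icc.2 hxy.le)).prodMk
      (hH x (Set.left_mem_Icc.2 hxy.le))).eventually
      (isClosed_diagonal.isOpen_compl.mem_nhds (x := (G x, H x)) hne)
    rw [nhdsWithin_Icc_eq_nhdsGE hxy] at hev
    obtain ⟨u, hu, hsub⟩ := mem_nhdsGE_iff_exists_Icc_subset.1 hev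
    obtain ⟨t, ht, hGt⟩ := h x (min u y) le_rfl (lt_min hu hxy) (min_le_right _ _)
    exact hsub ⟨ht.1, ht.2.trans (min_le_left _ _)⟩ hGt
  · have hev := ((hG y (Set.right_mem_Icc.2 hxy.le)).prodMk
      (hH y (Set.right_mem_Icc.2 hxy.le))).eventually
      (isClosed_diagonal.isOpen_compl.mem_nhds (x := (G y, H y)) hne)
    rw [nhdsWithin_Icc_eq_nhdsLE hxy] at hev
    obtain ⟨u, hu, hsub⟩ := mem_nhdsLE_iff_exists_Icc_subset.1 hev
    obtain ⟨t, ht, hGt⟩ := h (max u x) y (le_max_right _ _) (max_lt hu hxy) le_rfl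
    exact hsub ⟨(le_max_left _ _).trans ht.1, ht.2⟩ hGt

open Classical in
theorem continuousOn_extend_comp_exp {J : Set Circle} (g : C(J, ℂ)) {x y : ℝ}
    (h : ∀ t ∈ Set.Icc x y, Circle.exp t ∈ J) :
    ContinuousOn (fun t : ℝ => if ht : Circle.exp t ∈ J then g ⟨Circle.exp t, ht⟩ else 0)
      (Set.Icc x y) := by
  rw [continuousOn_iff_continuous_domRestrict]
  have hc : Continuous fun t : Set.Icc x y => g ⟨Circle.exp t, h t t.2⟩ :=
    g.continuous.comp (Continuous.subtype_mk (by fun_prop) _)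
  refine hc.congr fun t => ?_
  simp [h t t.2]

open Classical in
theorem subseqLimits_subsingleton {a : ℤ → ℂ} {c : ℕ → ℝ} (hc : ClassXMinus c)
    (ha : ∀ n : ℤ, ‖a n‖ ≤ Real.exp (c n.natAbs)) {J : Set Circle} (hJ : IsCircleInterval J) :
    (subseqLimits a J).Subsingleton := by
  rintro g ⟨m, hm, -, hg⟩ h ⟨m', hm', -, hh⟩
  obtain ⟨d, hmono, hd, hs, N₀, hN₀⟩ := hc.exists_monotone
  have ha' : ∀ n : ℤ, N₀ ≤ n.natAbs → ‖a n‖ ≤ Real.exp (d n.natAbs) := fun n hn => by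
    rw [hN₀ _ hn]; exact ha n
  ext ⟨z, hz⟩
  obtain ⟨x, y, hxy, hsub, hend⟩ :=
    exists_arc_subset hJ.isConnected.isPreconnected hJ.nontrivial hz
  have hGc := continuousOn_extend_comp_exp g hsub
  have hHc := continuousOn_extend_comp_exp h hsub
  have key := eq_endpoints_of_forall_exists_eq hxy hGc hHc fun u v hu huv hv => by
    have hIcc : Set.Icc u v ⊆ Set.Icc x y := Set.Icc_subset_Icc hu hv
    refine exists_limits_eq hmono hd hs ha' hm hm' huv (hGc.mono hIcc) (hHc.mono hIcc)
      (fun t ht => ?_) (fun t ht => ?_)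
    · simpa [hsub t (hIcc ht)] using hg ⟨_, hsub t (hIcc ht)⟩
    · simpa [hsub t (hIcc ht)] using hh ⟨_, hsub t (hIcc ht)⟩
  rcases hend with rfl | rfl
  · simpa [hz] using key.1
  · simpa [hz] using key.2

/-! ### Non-universality in `C_p(𝕋)` -/

theorem isCircleInterval_univ : IsCircleInterval (Set.univ : Set Circle) where
  isClosed := isClosed_univ
  isConnected := isConnected_univ
  length_pos := by
    have h : {t : ℝ | t ∈ Set.Ioc (-Real.pi) Real.pi ∧ Circle.exp t ∈ (Set.univ : Set Circle)}
        = Set.Ioc (-Real.pi) Real.pi := by ext; simp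
    rw [circleLength, h, Real.volume_Ioc]
    simp [Real.pi_pos]

/-- Evaluation at a point, as an additive map on `C_p(K)`. -/
noncomputable def Cp.evalHom {K : Type*} [TopologicalSpace K] (x : K) : Cp K →+ ℂ where
  toFun f := (show C(K, ℂ) from f) x
  map_zero' := rfl
  map_add' _ _ := rfl

theorem Cp.continuous_evalHom {K : Type*} [TopologicalSpace K] (x : K) :
    Continuous (Cp.evalHom x) :=
  (continuous_apply x).comp (Cp.isInducing K).continuous

theorem Cp.evalHom_sum_circleMonomial (a : ℤ → ℂ) (n : ℕ) (z : Circle) :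
    Cp.evalHom z (∑ j ∈ Finset.Icc (-(n : ℤ)) (n : ℤ), a j • circleMonomial j)
      = symPartialSum a n z := by
  rw [map_sum, symPartialSum]
  refine Finset.sum_congr rfl fun k _ => ?_
  change a k * ((z ^ k : Circle) : ℂ) = _
  rw [Circle.coe_zpow]

theorem IsUniversalBilateralSeries.mem_subseqLimits {a : ℤ → ℂ}
    (h : IsUniversalBilateralSeries (fun n : ℤ => a n • circleMonomial n)) (f : C(Circle, ℂ)) :
    f.restrict Set.univ ∈ subseqLimits a Set.univ := by
  obtain ⟨n, hn, hpos, hlim⟩ := h f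
  refine ⟨n, hn, hpos, fun z => ?_⟩
  refine (((Cp.continuous_evalHom (z : Circle)).tendsto _).comp hlim).congr fun k => ?_
  exact Cp.evalHom_sum_circleMonomial a (n k) z

theorem theorem1p6 (a : ℤ → ℂ)
    (ha : ∃ c : ℕ → ℝ, ClassXMinus c ∧ ∀ n : ℤ, ‖a n‖ ≤ Real.exp (c n.natAbs)) :
    (∀ J : Set Circle, IsCircleInterval J → (subseqLimits a J).Subsingleton) ∧
      ¬ IsUniversalBilateralSeries (fun n : ℤ => a n • circleMonomial n) := by
  obtain ⟨c, hc, hac⟩ := ha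
  refine ⟨fun J hJ => subseqLimits_subsingleton hc hac hJ, fun hU => ?_⟩
  -- Universality would make the constants 0 and 1 both subsequential limits on the whole circle.
  have h := subseqLimits_subsingleton hc hac isCircleInterval_univ
    (hU.mem_subseqLimits 0) (hU.mem_subseqLimits 1)
  simpa using DFunLike.congr_fun h ⟨1, Set.mem_univ _⟩
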